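/- Let $q$ be a real number with $0<q<1$. Write $(a)_\infty=\prod_{k=0}^\infty(1-aq^k)$ for $a\in\mathbb C$, let $\theta(x)=(x)_\infty\,(q/x)_\infty$ for $x\in\mathbb C\setminus\{0\}$, and let $\theta'$ denote the derivative of $\theta$. For an $n\times n$ matrix $(a_{ij})$, with $n$ even or odd, let $$\mathop{\mathrm{pfaff}}_{1\le i,j\le n}(a_{ij})=\frac1{2^M M!}\sum_{\sigma\in S_n}\operatorname{sgn}(\sigma)\prod_{i=1}^{M}a_{\sigma(2i-1),\sigma(2i)},\qquad M=\lfloor n/2\rfloor .$$ Let $m\ge 0$ be an integer. (a) For all non-zero complex numbers $x_1,\dots,x_{2m}$ such that $\theta(-x_j/x_i)\neq 0$ whenever $i\ne j$, $$\mathop{\mathrm{pfaff}}_{1\le i,j\le 2m}\left(\frac{\theta(x_j/x_i)}{\theta(-x_j/x_i)}\right)=\prod_{1\le i<j\le 2m}\frac{\theta(x_j/x_i)}{\theta(-x_j/x_i)}.$$ (b) For all non-zero complex numbers $x_1,\dots,x_{2m+1}$ such that $\theta(-x_j/x_i)\neq 0$ whenever $i\ne j$, $$\mathop{\mathrm{pfaff}}_{1\le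 i,j\le 2m+1}\left(1+2\,\frac{x_j\,\theta'(-x_j/x_i)}{x_i\,\theta(-x_j/x_i)}\right)=\frac{(q)_\infty^{2m}}{(-q)_\infty^{2m}}\prod_{1\le i<j\le 2m+1}\frac{\theta(x_j/x_i)}{\theta(-x_j/x_i)}.$$ -/

import Mathlib

open scoped Nat

/-- The `q`-shifted factorial `(a; q)_∞ = ∏_{k ≥ 0} (1 - a q^k)`. -/
noncomputable def qPochInf (a q : ℂ) : ℂ := ∏' k : ℕ, (1 - a * q ^ k)

/-- The theta function `θ(x; q) = (x; q)_∞ (q / x; q)_∞` (considered for `x ≠ 0`). -/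
noncomputable def ellTheta (q x : ℂ) : ℂ := qPochInf x q * qPochInf (q / x) q

/-- The derivative `θ'(x; q)` with respect to the argument `x`. -/
noncomputable def ellThetaDeriv (q x : ℂ) : ℂ := deriv (ellTheta q) x

/-- The pfaffian of an `m × m` matrix, for `m` even or odd: with `M = ⌊m / 2⌋`,
`pfaff A = 1 / (2^M M!) ∑_{σ ∈ S_m} sgn σ ∏_{i=1}^M A_{σ(2i-1), σ(2i)}`.
As indices of `Fin m` start at `0`, the pairs `(2i-1, 2i)`, `1 ≤ i ≤ M`, become
`(2i, 2i+1)`, `0 ≤ i < M`. -/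
noncomputable def pfaff {m : ℕ} (A : Matrix (Fin m) (Fin m) ℂ) : ℂ :=
  1 / ((2 : ℂ) ^ (m / 2) * ((m / 2)! : ℂ)) *
    ∑ σ : Equiv.Perm (Fin m), ((Equiv.Perm.sign σ : ℤ) : ℂ) *
      ∏ i : Fin (m / 2),
        A (σ ⟨2 * i.val, by have := i.isLt; omega⟩) (σ ⟨2 * i.val + 1, by have := i.isLt; omega⟩)

/-! Write `s(u,v)` for `thetaQuot q u v`, `L(u,v)` for `thetaLog q u v`, and `K = (q)_∞² / (-q)_∞²`.
Both `s` and `L` are antisymmetric. Everything rests on one relation: the coboundary of `L` is a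
product, `L(u,v) + L(v,w) - L(u,w) = K s(u,v) s(v,w) s(u,w)` (`thetaLog_add_sub`). It is proved by
Liouville's theorem. With denominators cleared, the difference of the two sides has the same
multiplier under `y ↦ q y` as `θ(-y) θ(-y z)` and, outside a degenerate case, vanishes at the simple
zeros of that product. Hence it is a constant multiple of it, and the value at `y = 1` shows that
the constant is 0.

A coboundary is a cocycle, so the four relations for the triples from `a, b, c, -d` have alternating
sum zero. Since `s(u,-d) = 1 / s(u,d)`, this is the case `m = 2` of (a) (`thetaQuot_four_term`).

For (a), the four-term relation says that eliminating the last two indices of `(s(x_i,x_j))` leaves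
the smaller matrix of the same kind, rescaled by a diagonal congruence. Induction on `m` follows
from `pfaff_schur` and `pfaff_scale`. For (b), an odd pfaffian equals the even one bordered by ones.
Eliminating the border together with the last variable turns `L` into a rescaled `s`, by the
coboundary relation, and (a) applies. -/

/-! ### Pfaffians: congruence, expansion and elimination -/

/-- The position `2 i` of the first element of the `i`-th pair. -/
def pairFst {M n : ℕ} (h : 2 * M ≤ n) (i : Fin M) : Fin n := ⟨2 * i.val, by omega⟩

/-- The position `2 i + 1` of the second element of the `i`-th pair. -/
def pairSnd {M n : ℕ} (h : 2 * M ≤ n) (i : Fin M) : Fin n := ⟨2 * i.val + 1, by omega⟩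

/-- The product of the entries of `A` at the first `M` pairs of values of `g`. -/
noncomputable def pairProd {M n : ℕ} {ι : Type*} (h : 2 * M ≤ n) (A : Matrix ι ι ℂ)
    (g : Fin n → ι) : ℂ :=
  ∏ i : Fin M, A (g (pairFst h i)) (g (pairSnd h i))

theorem pfaff_eq {M n : ℕ} (h : n / 2 = M) (h' : 2 * M ≤ n) (A : Matrix (Fin n) (Fin n) ℂ) :
    pfaff A = 1 / ((2 : ℂ) ^ M * (M ! : ℂ)) *
      ∑ σ : Equiv.Perm (Fin n), ((Equiv.Perm.sign σ : ℤ) : ℂ) * pairProd h' A σ := by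
  subst h
  rfl

theorem pairProd_update {M : ℕ} {V : Type*} [DecidableEq (Fin (2 * M))]
    (b : V → V → ℂ) (v : Fin (2 * M) → V) (k : Fin M) (j : Fin (2 * M))
    (hj : j = pairFst le_rfl k ∨ j = pairSnd le_rfl k) (x : V) :
    ∏ i : Fin M, b (Function.update v j x (pairFst le_rfl i))
        (Function.update v j x (pairSnd le_rfl i)) =
      b (Function.update v j x (pairFst le_rfl k)) (Function.update v j x (pairSnd le_rfl k)) *
        ∏ i ∈ Finset.univ.erase k, b (v (pairFst le_rfl i)) (v (pairSnd le_rfl i)) := by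
  rw [← Finset.mul_prod_erase _ _ (Finset.mem_univ k)]
  congr 1
  refine Finset.prod_congr rfl fun i hi => ?_
  have hik : i.val ≠ k.val := fun h => (Finset.mem_erase.1 hi).1 (Fin.ext h)
  rw [Function.update_of_ne, Function.update_of_ne]
  · rcases hj with rfl | rfl <;> simp only [pairFst, pairSnd, ne_eq, Fin.mk.injEq] <;> omega
  · rcases hj with rfl | rfl <;> simp only [pairFst, pairSnd, ne_eq, Fin.mk.injEq] <;> omega

theorem exists_pair {M : ℕ} (j : Fin (2 * M)) :
    ∃ k : Fin M, j = pairFst le_rfl k ∨ j = pairSnd le_rfl k := by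
  refine ⟨⟨j.val / 2, by omega⟩, ?_⟩
  simp only [pairFst, pairSnd, Fin.ext_iff]
  omega

theorem pairFst_ne_pairSnd {M n : ℕ} (h : 2 * M ≤ n) (i k : Fin M) :
    pairFst h i ≠ pairSnd h k := by
  simp only [pairFst, pairSnd, ne_eq, Fin.mk.injEq]
  omega

/-- The product of the values of a bilinear form at consecutive pairs of vectors. -/
noncomputable def pairForm {M : ℕ} {V : Type*} [AddCommGroup V] [Module ℂ V]
    (b : V →ₗ[ℂ] V →ₗ[ℂ] ℂ) : MultilinearMap ℂ (fun _ : Fin (2 * M) => V) ℂ where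
  toFun v := ∏ i : Fin M, b (v (pairFst le_rfl i)) (v (pairSnd le_rfl i))
  map_update_add' := by
    intro inst v j x y
    obtain ⟨k, hk⟩ := exists_pair j
    simp only [pairProd_update (fun x y => b x y) v k j hk]
    rw [← add_mul]
    congr 1
    rcases hk with rfl | rfl
    · simp [Function.update_of_ne (pairFst_ne_pairSnd le_rfl k k).symm]
    · simp [Function.update_of_ne (pairFst_ne_pairSnd le_rfl k k)]
  map_update_smul' := by
    intro inst v j c x
    obtain ⟨k, hk⟩ := exists_pair j
    simp only [pairProd_update (fun x y => b x y) v k j hk]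
    rw [smul_eq_mul, ← mul_assoc]
    congr 1
    rcases hk with rfl | rfl
    · simp [Function.update_of_ne (pairFst_ne_pairSnd le_rfl k k).symm]
    · simp [Function.update_of_ne (pairFst_ne_pairSnd le_rfl k k)]

/-- The sum is the alternatization of `pairForm` evaluated at the rows of `B`. An alternating form
in `2 M` vectors of a `2 M`-dimensional space is a multiple of the determinant, and the multiple is
its value at the standard basis. -/
theorem sum_sign_pairProd_congruence {M : ℕ} (A B : Matrix (Fin (2 * M)) (Fin (2 * M)) ℂ) :
    ∑ σ : Equiv.Perm (Fin (2 * M)), ((Equiv.Perm.sign σ : ℤ) : ℂ) *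
        pairProd le_rfl (B * A * B.transpose) σ =
      B.det * ∑ σ : Equiv.Perm (Fin (2 * M)), ((Equiv.Perm.sign σ : ℤ) : ℂ) *
        pairProd le_rfl A σ := by
  have key (C : Matrix (Fin (2 * M)) (Fin (2 * M)) ℂ) :
      MultilinearMap.alternatization (pairForm (M := M) (Matrix.toLinearMap₂' ℂ A)) C.row =
      ∑ σ : Equiv.Perm (Fin (2 * M)), ((Equiv.Perm.sign σ : ℤ) : ℂ) *
        pairProd le_rfl (C * A * C.transpose) σ := by
    rw [MultilinearMap.alternatization_apply]
    refine Finset.sum_congr rfl fun σ _ => ?_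
    rw [Units.smul_def, zsmul_eq_mul]
    congr 1
    simp only [MultilinearMap.domDomCongr_apply, pairForm, MultilinearMap.coe_mk, pairProd]
    refine Finset.prod_congr rfl fun i _ => ?_
    rw [Matrix.toLinearMap₂'_apply']
    rw [Matrix.mul_assoc, Matrix.mul_apply']
    congr 1
  have h := (MultilinearMap.alternatization
    (pairForm (M := M) (Matrix.toLinearMap₂' ℂ A))).eq_smul_basis_det (Pi.basisFun ℂ _)
  have h1 := key B
  have h2 := key 1
  rw [h] at h1
  simp only [Matrix.one_mul, Matrix.transpose_one, Matrix.mul_one] at h2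
  rw [← h1, ← h2, Pi.basisFun_det, AlternatingMap.smul_apply, smul_eq_mul, mul_comm]
  congr 1
  congr 1
  ext i j
  simp [Matrix.row, Pi.single_apply, Matrix.one_apply, eq_comm]

theorem pfaff_congruence {M : ℕ} (A B : Matrix (Fin (2 * M)) (Fin (2 * M)) ℂ) :
    pfaff (B * A * B.transpose) = B.det * pfaff A := by
  rw [pfaff_eq (M := M) (by omega) le_rfl, pfaff_eq (M := M) (by omega) le_rfl,
    sum_sign_pairProd_congruence]
  ring

/-- The extension of a permutation of `Fin n` to `Fin (n + 1)` fixing the last element. -/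
def permCastSucc {n : ℕ} (τ : Equiv.Perm (Fin n)) : Equiv.Perm (Fin (n + 1)) :=
  finSuccEquivLast.symm.permCongr τ.optionCongr

theorem permCastSucc_castSucc {n : ℕ} (τ : Equiv.Perm (Fin n)) (i : Fin n) :
    permCastSucc τ i.castSucc = (τ i).castSucc := by
  simp [permCastSucc, Equiv.permCongr_apply]

theorem permCastSucc_last {n : ℕ} (τ : Equiv.Perm (Fin n)) :
    permCastSucc τ (Fin.last n) = Fin.last n := by
  simp [permCastSucc, Equiv.permCongr_apply]

theorem sign_permCastSucc {n : ℕ} (τ : Equiv.Perm (Fin n)) :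
    Equiv.Perm.sign (permCastSucc τ) = Equiv.Perm.sign τ := by
  simp [permCastSucc]

theorem sum_perm_fix_last {n : ℕ} (F : Equiv.Perm (Fin (n + 1)) → ℂ) :
    ∑ σ : Equiv.Perm (Fin (n + 1)), (if σ (Fin.last n) = Fin.last n then F σ else 0) =
      ∑ τ : Equiv.Perm (Fin n), F (permCastSucc τ) := by
  rw [← Equiv.sum_comp (finSuccEquivLast (n := n)).symm.permCongr,
    ← Equiv.sum_comp Equiv.Perm.decomposeOption.symm, Fintype.sum_prod_type,
    Fintype.sum_option]
  simp [Equiv.permCongr_apply, permCastSucc]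
  rfl

theorem pairProd_flip {M n : ℕ} {ι : Type*} (h : 2 * M ≤ n) {A : Matrix ι ι ℂ}
    (hA : ∀ i j, A j i = -A i j) (g : Fin n → ι) (k : Fin M) :
    pairProd h A (g ∘ Equiv.swap (pairFst h k) (pairSnd h k)) = -pairProd h A g := by
  unfold pairProd
  rw [← Finset.mul_prod_erase _ _ (Finset.mem_univ k),
    ← Finset.mul_prod_erase (a := k) _ (fun i => A (g _) _) (Finset.mem_univ k), ← neg_mul, ← hA]
  congr 1
  · simp
  refine Finset.prod_congr rfl fun i hi => ?_
  have hik : i.val ≠ k.val := fun h => (Finset.mem_erase.1 hi).1 (Fin.ext h)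
  simp only [Function.comp_apply]
  rw [Equiv.swap_apply_of_ne_of_ne, Equiv.swap_apply_of_ne_of_ne] <;>
    simp only [pairFst, pairSnd, ne_eq, Fin.mk.injEq] <;> omega

theorem pairProd_swap_pairs {M n : ℕ} {ι : Type*} (h : 2 * M ≤ n) (A : Matrix ι ι ℂ)
    (g : Fin n → ι) (k l : Fin M) :
    pairProd h A (g ∘ (Equiv.swap (pairFst h k) (pairFst h l) *
      Equiv.swap (pairSnd h k) (pairSnd h l) : Equiv.Perm (Fin n))) = pairProd h A g := by
  unfold pairProd
  rw [← Equiv.prod_comp (Equiv.swap k l) (fun i => A (g (pairFst h i)) _)]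
  have hinj1 : Function.Injective (pairFst h) := fun a b hab => by
    simp only [pairFst, Fin.mk.injEq] at hab; omega
  have hinj2 : Function.Injective (pairSnd h) := fun a b hab => by
    simp only [pairSnd, Fin.mk.injEq] at hab; omega
  refine Finset.prod_congr rfl fun i _ => ?_
  simp only [Function.comp_apply, Equiv.Perm.coe_mul]
  rw [Equiv.swap_apply_of_ne_of_ne (pairFst_ne_pairSnd h _ _) (pairFst_ne_pairSnd h _ _),
    ← hinj1.map_swap, ← hinj2.map_swap,
    Equiv.swap_apply_of_ne_of_ne (pairFst_ne_pairSnd h _ _).symm (pairFst_ne_pairSnd h _ _).symm]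

/-- Exchanging two whole pairs is an even permutation that fixes the product; flipping one pair
changes the sign of both factors. These moves carry the last position to any other, so in the
expansion all positions of a given value contribute equally. -/
theorem exists_perm_pairProd {M : ℕ} {A : Matrix (Fin (2 * M + 2)) (Fin (2 * M + 2)) ℂ}
    (hA : ∀ i j, A j i = -A i j) (h : 2 * (M + 1) ≤ 2 * M + 2) (p : Fin (2 * M + 2)) :
    ∃ π : Equiv.Perm (Fin (2 * M + 2)), π (Fin.last _) = p ∧
      ∀ σ : Equiv.Perm (Fin (2 * M + 2)),
        ((Equiv.Perm.sign (σ * π) : ℤ) : ℂ) * pairProd h A ⇑(σ * π) =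
          ((Equiv.Perm.sign σ : ℤ) : ℂ) * pairProd h A σ := by
  have hlast : Fin.last (2 * M + 1) = pairSnd h (Fin.last M) := by
    simp [pairSnd, Fin.ext_iff]
  have step (k : Fin (M + 1)) : ∃ π : Equiv.Perm (Fin (2 * M + 2)),
      π (Fin.last _) = pairSnd h k ∧
      ∀ σ : Equiv.Perm (Fin (2 * M + 2)),
        ((Equiv.Perm.sign (σ * π) : ℤ) : ℂ) * pairProd h A ⇑(σ * π) =
          ((Equiv.Perm.sign σ : ℤ) : ℂ) * pairProd h A σ := by
    refine ⟨Equiv.swap (pairFst h k) (pairFst h (Fin.last M)) *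
      Equiv.swap (pairSnd h k) (pairSnd h (Fin.last M)), ?_, fun σ => ?_⟩
    · rw [hlast, Equiv.Perm.mul_apply, Equiv.swap_apply_right,
        Equiv.swap_apply_of_ne_of_ne (pairFst_ne_pairSnd h _ _).symm
          (pairFst_ne_pairSnd h _ _).symm]
    · rw [Equiv.Perm.coe_mul σ, pairProd_swap_pairs]
      congr 3
      rcases eq_or_ne k (Fin.last M) with rfl | hk
      · simp
      · rw [Equiv.Perm.sign_mul, Equiv.Perm.sign_mul, Equiv.Perm.sign_swap,
          Equiv.Perm.sign_swap]
        · simp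
        · simp only [pairSnd, ne_eq, Fin.ext_iff] at hk ⊢
          omega
        · simp only [pairFst, ne_eq, Fin.ext_iff] at hk ⊢
          omega
  obtain ⟨k, hk⟩ : ∃ k : Fin (M + 1), p = pairFst h k ∨ p = pairSnd h k := by
    refine ⟨⟨p.val / 2, by omega⟩, ?_⟩
    simp only [pairFst, pairSnd, Fin.ext_iff]
    omega
  obtain ⟨π, h1, h2⟩ := step k
  rcases hk with rfl | rfl
  · refine ⟨Equiv.swap (pairFst h k) (pairSnd h k) * π, ?_, fun σ => ?_⟩
    · rw [Equiv.Perm.mul_apply, h1, Equiv.swap_apply_right]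
    · rw [← mul_assoc, h2, Equiv.Perm.coe_mul, pairProd_flip h hA, Equiv.Perm.sign_mul,
        Equiv.Perm.sign_swap (pairFst_ne_pairSnd h k k)]
      simp
  · exact ⟨π, h1, h2⟩

theorem pfaff_expand_last {M : ℕ} {A : Matrix (Fin (2 * M + 2)) (Fin (2 * M + 2)) ℂ}
    (hA : ∀ i j, A j i = -A i j) :
    pfaff A = 1 / ((2 : ℂ) ^ M * (M ! : ℂ)) *
      ∑ τ : Equiv.Perm (Fin (2 * M + 1)), ((Equiv.Perm.sign τ : ℤ) : ℂ) *
        pairProd (M := M) (by omega) (A.submatrix Fin.castSucc Fin.castSucc) τ *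
          A (τ (Fin.last _)).castSucc (Fin.last _) := by
  have h : 2 * (M + 1) ≤ 2 * M + 2 := by omega
  set T : Equiv.Perm (Fin (2 * M + 2)) → ℂ := fun σ =>
    ((Equiv.Perm.sign σ : ℤ) : ℂ) * pairProd h A σ with hT
  -- Sort the permutations by the position `p` at which the last value occurs. The factor `2 * M + 2
  -- = 2 * (M + 1)` then lowers the normalization from `M + 1` pairs to `M`.
  have hsum : ∑ σ, T σ = (2 * M + 2) *
      ∑ σ : Equiv.Perm (Fin (2 * M + 2)), if σ (Fin.last _) = Fin.last _ then T σ else 0 := by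
    have h1 (σ : Equiv.Perm (Fin (2 * M + 2))) :
        T σ = ∑ p, if σ p = Fin.last _ then T σ else 0 := by
      simp_rw [← Equiv.eq_symm_apply]
      simp
    rw [Finset.sum_congr rfl fun σ _ => h1 σ, Finset.sum_comm]
    have h2 (p : Fin (2 * M + 2)) :
        ∑ σ : Equiv.Perm (Fin (2 * M + 2)), (if σ p = Fin.last _ then T σ else 0) =
        ∑ σ : Equiv.Perm (Fin (2 * M + 2)), if σ (Fin.last _) = Fin.last _ then T σ else 0 := by
      obtain ⟨π, rfl, hπ⟩ := exists_perm_pairProd hA h p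
      rw [← Equiv.sum_comp (Equiv.mulRight π)
        (fun σ => if σ (Fin.last _) = Fin.last _ then T σ else 0)]
      refine Finset.sum_congr rfl fun σ _ => ?_
      simp only [Equiv.coe_mulRight, Equiv.Perm.mul_apply, hT, hπ]
    rw [Finset.sum_congr rfl fun p _ => h2 p]
    simp
  rw [pfaff_eq (M := M + 1) (by omega) h, hsum, sum_perm_fix_last, Nat.factorial_succ]
  have h3 (τ : Equiv.Perm (Fin (2 * M + 1))) : T (permCastSucc τ) =
      ((Equiv.Perm.sign τ : ℤ) : ℂ) *
        pairProd (M := M) (by omega) (A.submatrix Fin.castSucc Fin.castSucc) τ *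
          A (τ (Fin.last _)).castSucc (Fin.last _) := by
    simp only [hT, sign_permCastSucc, mul_assoc]
    congr 1
    unfold pairProd
    rw [Fin.prod_univ_castSucc]
    have e1 : pairFst h (Fin.last M) = (Fin.last (2 * M)).castSucc := rfl
    have e2 : pairSnd h (Fin.last M) = Fin.last (2 * M + 1) := rfl
    rw [e1, e2, permCastSucc_castSucc, permCastSucc_last]
    congr 1
    refine Finset.prod_congr rfl fun i _ => ?_
    have e3 : pairFst h i.castSucc = (pairFst (n := 2 * M + 1) (by omega) i).castSucc := rfl
    have e4 : pairSnd h i.castSucc = (pairSnd (n := 2 * M + 1) (by omega) i).castSucc := rfl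
    rw [e3, e4, permCastSucc_castSucc, permCastSucc_castSucc]
    rfl
  rw [Finset.sum_congr rfl fun τ _ => h3 τ, ← mul_assoc]
  congr 1
  have : (M ! : ℂ) ≠ 0 := mod_cast M.factorial_ne_zero
  have : (M : ℂ) + 1 ≠ 0 := mod_cast M.succ_ne_zero
  push_cast
  field_simp
  ring

/-- In the expansion the index left unpaired by an odd pfaffian is paired with the border, at the
cost of a factor 1. -/
theorem pfaff_border {M : ℕ} {A : Matrix (Fin (2 * M + 2)) (Fin (2 * M + 2)) ℂ}
    (hA : ∀ i j, A j i = -A i j) (h1 : ∀ i : Fin (2 * M + 1), A i.castSucc (Fin.last _) = 1) :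
    pfaff A = pfaff (A.submatrix Fin.castSucc Fin.castSucc) := by
  rw [pfaff_expand_last hA, pfaff_eq (M := M) (by omega) (by omega)]
  simp [h1]

theorem pfaff_block {M : ℕ} {A : Matrix (Fin (2 * M + 2)) (Fin (2 * M + 2)) ℂ}
    (hA : ∀ i j, A j i = -A i j)
    (h0 : ∀ i : Fin (2 * M), A i.castSucc.castSucc (Fin.last _) = 0) :
    pfaff A = A (Fin.last (2 * M)).castSucc (Fin.last _) *
      pfaff (A.submatrix (fun i : Fin (2 * M) => i.castSucc.castSucc)
        fun i : Fin (2 * M) => i.castSucc.castSucc) := by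
  rw [pfaff_expand_last hA, pfaff_eq (M := M) (by omega) le_rfl]
  have h (τ : Equiv.Perm (Fin (2 * M + 1))) (c : ℂ) : c * A (τ (Fin.last _)).castSucc (Fin.last _) =
      if τ (Fin.last _) = Fin.last _ then
        c * A (Fin.last (2 * M)).castSucc (Fin.last _) else 0 := by
    split_ifs with hτ
    · rw [hτ]
    · obtain ⟨j, hj⟩ := Fin.exists_castSucc_eq.2 hτ
      rw [← hj, h0, mul_zero]
  simp_rw [h]
  rw [sum_perm_fix_last, ← Finset.sum_mul, ← mul_assoc, mul_comm]
  congr 2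
  refine Finset.sum_congr rfl fun τ _ => ?_
  rw [sign_permCastSucc]
  congr 1
  refine Finset.prod_congr rfl fun i _ => ?_
  have e3 : pairFst (n := 2 * M + 1) (by omega) i =
    (pairFst (n := 2 * M) le_rfl i).castSucc := rfl
  have e4 : pairSnd (n := 2 * M + 1) (by omega) i =
    (pairSnd (n := 2 * M) le_rfl i).castSucc := rfl
  rw [e3, e4, permCastSucc_castSucc, permCastSucc_castSucc]
  rfl

/-- Gaussian elimination with the pivot `A e l`: a unipotent congruence leaves the pfaffian
unchanged and clears the last column, and `pfaff_block` then splits off the pivot. -/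
theorem pfaff_schur {M : ℕ} {A : Matrix (Fin (2 * M + 2)) (Fin (2 * M + 2)) ℂ}
    (hA : ∀ i j, A j i = -A i j) {e l : Fin (2 * M + 2)} (he : e = (Fin.last (2 * M)).castSucc)
    (hl : l = Fin.last (2 * M + 1)) (hp : A e l ≠ 0) :
    pfaff A = A e l * pfaff (Matrix.of fun i j : Fin (2 * M) =>
      A i.castSucc.castSucc j.castSucc.castSucc -
        (A i.castSucc.castSucc e * A j.castSucc.castSucc l -
          A i.castSucc.castSucc l * A j.castSucc.castSucc e) / A e l) := by
  set p := A e l with hpdef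
  -- Adding `α r` times row `e` clears column `l`, and adding `β r` times row `l` clears column `e`.
  -- Both vanish at `e` and `l`, so `B` is upper triangular with unit diagonal.
  let α : Fin (2 * M + 2) → ℂ := fun r => if r < e then -A r l / p else 0
  let β : Fin (2 * M + 2) → ℂ := fun r => if r < e then A r e / p else 0
  have hel : e < l := by rw [he, hl]; exact Fin.castSucc_lt_last _
  have hαe : α e = 0 := by simp [α]
  have hβe : β e = 0 := by simp [β]
  have hαl : α l = 0 := by simp [α, hel.le]
  have hβl : β l = 0 := by simp [β, hel.le]
  have hιe (i : Fin (2 * M)) : i.castSucc.castSucc < e := by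
    rw [he]; exact Fin.castSucc_lt_castSucc_iff.2 (Fin.castSucc_lt_last _)
  let B : Matrix (Fin (2 * M + 2)) (Fin (2 * M + 2)) ℂ :=
    1 + Matrix.vecMulVec α (Pi.single e 1) + Matrix.vecMulVec β (Pi.single l 1)
  have hdet : B.det = 1 := by
    rw [Matrix.det_of_isUpperTriangular]
    · refine Finset.prod_eq_one fun i _ => ?_
      have h1 : α i * (Pi.single e 1 : Fin (2 * M + 2) → ℂ) i = 0 := by
        rcases eq_or_ne i e with rfl | h
        · rw [hαe, zero_mul]
        · rw [Pi.single_eq_of_ne h, mul_zero]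
      have h2 : β i * (Pi.single l 1 : Fin (2 * M + 2) → ℂ) i = 0 := by
        rcases eq_or_ne i l with rfl | h
        · rw [hβl, zero_mul]
        · rw [Pi.single_eq_of_ne h, mul_zero]
      simp [B, Matrix.vecMulVec_apply, h1, h2]
    · intro i j hij
      have hij : j < i := hij
      have h1 : α i * (Pi.single e 1 : Fin (2 * M + 2) → ℂ) j = 0 := by
        rcases eq_or_ne j e with rfl | h
        · simp [α, hij.le]
        · rw [Pi.single_eq_of_ne h, mul_zero]
      have h2 : β i * (Pi.single l 1 : Fin (2 * M + 2) → ℂ) j = 0 := by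
        rcases eq_or_ne j l with rfl | h
        · simp [β, (hel.trans hij).le]
        · rw [Pi.single_eq_of_ne h, mul_zero]
      simp [B, Matrix.vecMulVec_apply, h1, h2, Matrix.one_apply_ne hij.ne']
  have hBA (X : Matrix (Fin (2 * M + 2)) (Fin (2 * M + 2)) ℂ) (r s) :
      (B * X) r s = X r s + α r * X e s + β r * X l s := by
    simp only [B, Matrix.add_mul, Matrix.one_mul, Matrix.vecMulVec_mul, Matrix.add_apply,
      Matrix.vecMulVec_apply, Matrix.single_one_vecMul]
    rfl
  have hC (r s) : (B * A * B.transpose) r s = (A r s + α r * A e s + β r * A l s) +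
      α s * (A r e + α r * A e e + β r * A l e) + β s * (A r l + α r * A e l + β r * A l l) := by
    have : (B * A * B.transpose) r s = (B * (B * A).transpose) s r := by
      rw [← Matrix.transpose_apply (B * (B * A).transpose), Matrix.transpose_mul,
        Matrix.transpose_transpose]
    rw [this, hBA]
    simp only [Matrix.transpose_apply, hBA]
  have hdiag (i) : A i i = 0 := by
    have := hA i i
    linear_combination (1 / 2) * this
  have hle : A l e = -p := hA e l
  have hp' : A e l = p := rfl
  have hanti (i j) : (B * A * B.transpose) j i = -(B * A * B.transpose) i j := by
    rw [hC, hC, hA i j, hA j e, hA j l, hA i e, hA i l, hdiag, hdiag, hle, hp']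
    ring
  have hzl (i : Fin (2 * M)) : (B * A * B.transpose) i.castSucc.castSucc l = 0 := by
    rw [hC, hαl, hβl, hdiag l, hp']
    simp only [α, hιe, if_true]
    field_simp
    ring
  have hmain := pfaff_congruence (M := M + 1) A B
  rw [hdet, one_mul] at hmain
  have hblock := pfaff_block (M := M) hanti (by rw [← hl]; exact hzl)
  rw [← he, ← hl] at hblock
  refine hmain.symm.trans (hblock.trans ?_)
  congr 1
  · rw [hC, hαl, hβl, hαe, hβe]
    ring
  · congr 1
    ext i j
    simp only [Matrix.submatrix_apply, Matrix.of_apply]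
    rw [hC, hA _ e, hA _ l, hdiag, hdiag, hle, hp']
    simp only [α, β, hιe, if_true]
    field_simp
    ring

theorem pfaff_scale {M : ℕ} (A : Matrix (Fin (2 * M)) (Fin (2 * M)) ℂ) (d : Fin (2 * M) → ℂ) :
    pfaff (Matrix.of fun i j => d i * d j * A i j) = (∏ i, d i) * pfaff A := by
  rw [← Matrix.det_diagonal, ← pfaff_congruence]
  congr 1
  ext i j
  rw [Matrix.diagonal_transpose, Matrix.mul_diagonal, Matrix.diagonal_mul]
  simp only [Matrix.of_apply]
  ring

theorem pfaff_const_mul {M : ℕ} (A : Matrix (Fin (2 * M)) (Fin (2 * M)) ℂ) (c : ℂ) :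
    pfaff (Matrix.of fun i j => c * A i j) = c ^ M * pfaff A := by
  rw [pfaff_eq (M := M) (by omega) le_rfl, pfaff_eq (M := M) (by omega) le_rfl]
  simp only [pairProd, Matrix.of_apply, Finset.prod_mul_distrib, Finset.prod_const,
    Finset.card_univ, Fintype.card_fin]
  simp_rw [Finset.mul_sum]
  refine Finset.sum_congr rfl fun σ _ => ?_
  ring

theorem pfaff_eq_zero_of_proportional {M : ℕ} {A : Matrix (Fin (2 * M)) (Fin (2 * M)) ℂ}
    (hA : ∀ i j, A j i = -A i j) {e l : Fin (2 * M)} (hel : e ≠ l) (ε : ℂ)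
    (h : ∀ j, A l j = ε * A e j) : pfaff A = 0 := by
  have hdiag (i) : A i i = 0 := by
    have := hA i i
    linear_combination (1 / 2) * this
  -- Replacing row `l` by `ε` times row `e` does not change `A`, but is a singular operation: column
  -- `l` of `B` is zero.
  let B : Matrix (Fin (2 * M)) (Fin (2 * M)) ℂ := Matrix.updateRow 1 l (Pi.single e ε)
  have hdet : B.det = 0 := by
    refine Matrix.det_eq_zero_of_column_eq_zero l fun i => ?_
    rcases eq_or_ne i l with rfl | hi
    · simp [B, Pi.single_eq_of_ne hel.symm]
    · simp [B, Matrix.updateRow_ne hi, Matrix.one_apply_ne hi]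
  have hBA (X : Matrix (Fin (2 * M)) (Fin (2 * M)) ℂ) (hX : ∀ j, X l j = ε * X e j) :
      B * X = X := by
    ext i j
    rcases eq_or_ne i l with rfl | hi
    · simp [B, Matrix.mul_apply, hX, Pi.single_apply]
    · simp [B, Matrix.mul_apply, Matrix.updateRow_ne hi, Matrix.one_apply]
  have h2 : A * B.transpose = A := by
    have := congrArg Matrix.transpose (hBA A.transpose fun j => by
      simp only [Matrix.transpose_apply, hA l j, hA e j, h]; ring)
    simpa [Matrix.transpose_mul] using this
  have := pfaff_congruence A B
  rwa [hBA A h, h2, hdet, zero_mul] at this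

/-! ### Convergence, zeros and holomorphy of the infinite product -/

theorem summable_norm_qPochInf_factor {q : ℂ} (hq : ‖q‖ < 1) (a : ℂ) :
    Summable fun k : ℕ => ‖-(a * q ^ k)‖ := by
  simpa using (summable_geometric_of_lt_one (norm_nonneg _) hq).mul_left ‖a‖

theorem multipliable_qPochInf {q : ℂ} (hq : ‖q‖ < 1) (a : ℂ) :
    Multipliable fun k : ℕ => 1 - a * q ^ k := by
  simpa [sub_eq_add_neg] using
    multipliable_one_add_of_summable (summable_norm_qPochInf_factor hq a)

theorem qPochInf_eq_mul {q : ℂ} (hq : ‖q‖ < 1) (a : ℂ) :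
    qPochInf a q = (1 - a) * qPochInf (a * q) q := by
  unfold qPochInf
  rw [tprod_eq_zero_mul' (f := fun k : ℕ => 1 - a * q ^ k)]
  · simp [pow_succ', mul_assoc]
  · simpa [pow_succ', mul_assoc] using multipliable_qPochInf hq (a * q)

theorem qPochInf_ne_zero {q : ℂ} (hq : ‖q‖ < 1) {a : ℂ} (ha : ∀ k : ℕ, a * q ^ k ≠ 1) :
    qPochInf a q ≠ 0 := by
  simpa [qPochInf, sub_eq_add_neg] using
    tprod_one_add_ne_zero_of_summable (f := fun k : ℕ => -(a * q ^ k))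
      (fun k => by rw [← sub_eq_add_neg]; exact sub_ne_zero.2 (ha k).symm)
      (summable_norm_qPochInf_factor hq a)

theorem qPochInf_ne_zero_of_norm_lt_one {q : ℂ} (hq : ‖q‖ < 1) {a : ℂ} (ha : ‖a‖ < 1) :
    qPochInf a q ≠ 0 :=
  qPochInf_ne_zero hq fun k h => by
    have h1 : ‖a‖ * ‖q‖ ^ k = 1 := by rw [← norm_pow, ← norm_mul, h, norm_one]
    have h2 : ‖q‖ ^ k ≤ 1 := pow_le_one₀ (norm_nonneg _) hq.le
    nlinarith [norm_nonneg a]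

theorem differentiable_qPochInf {q : ℂ} (hq : ‖q‖ < 1) :
    Differentiable ℂ fun a => qPochInf a q := by
  intro a
  set R := ‖a‖ + 1
  have hU : IsOpen (Metric.ball (0 : ℂ) R) := Metric.isOpen_ball
  have h := Summable.hasProdLocallyUniformlyOn_nat_one_add (f := fun (k : ℕ) (a : ℂ) => -(a * q ^ k))
    hU (u := fun k => R * ‖q‖ ^ k)
    ((summable_geometric_of_lt_one (norm_nonneg _) hq).mul_left R)
    (.of_forall fun k x hx => by
      simp only [norm_neg, norm_mul, norm_pow]
      have : ‖x‖ ≤ R := by simpa using (mem_ball_zero_iff.1 hx).le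
      gcongr)
    (fun k => by fun_prop)
  have hd : DifferentiableOn ℂ (fun a => ∏' k : ℕ, (1 + -(a * q ^ k))) (Metric.ball (0 : ℂ) R) :=
    h.differentiableOn (.of_forall fun _ => by
      simpa [Finset.prod_fn] using DifferentiableOn.finsetProd (fun _ _ => by fun_prop)) hU
  have := hd.differentiableAt (hU.mem_nhds (mem_ball_zero_iff.2 (lt_add_one _)))
  simpa only [qPochInf, sub_eq_add_neg] using this

/-! ### Quasi-periodicity and zeros of theta, and Liouville's theorem on `ℂ \ {0}` modulo `q` -/

section theta

variable {q : ℂ}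

theorem differentiableAt_ellTheta (hq : ‖q‖ < 1) {x : ℂ} (hx : x ≠ 0) :
    DifferentiableAt ℂ (ellTheta q) x := by
  have h := differentiable_qPochInf hq
  have h2 : DifferentiableAt ℂ (fun x : ℂ => q / x) x :=
    (differentiableAt_const q).div differentiableAt_id hx
  exact (h x).mul ((h (q / x)).comp x h2)

theorem differentiableOn_ellTheta (hq : ‖q‖ < 1) :
    DifferentiableOn ℂ (ellTheta q) {0}ᶜ :=
  fun _ hx => (differentiableAt_ellTheta hq hx).differentiableWithinAt

theorem differentiableAt_ellThetaDeriv (hq : ‖q‖ < 1) {x : ℂ} (hx : x ≠ 0) :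
    DifferentiableAt ℂ (ellThetaDeriv q) x :=
  ((differentiableOn_ellTheta hq).deriv isOpen_compl_singleton).differentiableAt
    (isOpen_compl_singleton.mem_nhds hx)

theorem ellTheta_q_mul (hq0 : q ≠ 0) (hq : ‖q‖ < 1) {x : ℂ} (hx : x ≠ 0) :
    ellTheta q (q * x) = -ellTheta q x / x := by
  unfold ellTheta
  have h : q / (q * x) = 1 / x := by field_simp
  rw [h, qPochInf_eq_mul hq (1 / x), qPochInf_eq_mul hq x, mul_comm q x, one_div_mul_eq_div]
  field_simp
  ring

theorem ellTheta_inv (hq : ‖q‖ < 1) {x : ℂ} (hx : x ≠ 0) :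
    ellTheta q x⁻¹ = -ellTheta q x / x := by
  unfold ellTheta
  rw [div_inv_eq_mul, qPochInf_eq_mul hq x⁻¹, qPochInf_eq_mul hq x, mul_comm q x,
    inv_mul_eq_div]
  field_simp
  ring

theorem ellTheta_eq_one_sub_mul (hq : ‖q‖ < 1) (x : ℂ) :
    ellTheta q x = (1 - x) * (qPochInf (x * q) q * qPochInf (q / x) q) := by
  unfold ellTheta
  rw [qPochInf_eq_mul hq x]
  ring

theorem ellTheta_one (hq : ‖q‖ < 1) : ellTheta q 1 = 0 := by
  simp [ellTheta_eq_one_sub_mul hq]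

theorem ellTheta_neg_one (hq : ‖q‖ < 1) : ellTheta q (-1) = 2 * qPochInf (-q) q ^ 2 := by
  rw [ellTheta_eq_one_sub_mul hq, div_neg, div_one, neg_one_mul]
  ring

theorem ellThetaDeriv_one (hq : ‖q‖ < 1) : ellThetaDeriv q 1 = -qPochInf q q ^ 2 := by
  have hd : DifferentiableAt ℂ (fun x : ℂ => qPochInf (x * q) q * qPochInf (q / x) q) 1 := by
    have h := differentiable_qPochInf hq
    have h2 : DifferentiableAt ℂ (fun x : ℂ => q / x) 1 :=
      (differentiableAt_const q).div differentiableAt_id one_ne_zero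
    exact ((h _).comp (1 : ℂ) (differentiableAt_id.mul_const q)).mul ((h _).comp (1 : ℂ) h2)
  have h1 : HasDerivAt (fun x : ℂ => 1 - x) (-1) 1 := by
    simpa using (hasDerivAt_id (1 : ℂ)).const_sub 1
  have h2 := h1.mul hd.hasDerivAt
  have h3 : ellTheta q =
      (fun x : ℂ => 1 - x) * fun x : ℂ => qPochInf (x * q) q * qPochInf (q / x) q :=
    funext fun x => ellTheta_eq_one_sub_mul hq x
  rw [ellThetaDeriv, h3, h2.deriv]
  simp
  ring

theorem qPochInf_self_ne_zero (hq : ‖q‖ < 1) : qPochInf q q ≠ 0 :=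
  qPochInf_ne_zero_of_norm_lt_one hq hq

theorem qPochInf_neg_self_ne_zero (hq : ‖q‖ < 1) : qPochInf (-q) q ≠ 0 :=
  qPochInf_ne_zero_of_norm_lt_one hq (by rwa [norm_neg])

theorem ellTheta_neg_one_ne_zero (hq : ‖q‖ < 1) : ellTheta q (-1) ≠ 0 := by
  rw [ellTheta_neg_one hq]
  exact mul_ne_zero two_ne_zero (pow_ne_zero _ (qPochInf_neg_self_ne_zero hq))

theorem ellThetaDeriv_q_mul (hq0 : q ≠ 0) (hq : ‖q‖ < 1) {x : ℂ} (hx : x ≠ 0) :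
    ellThetaDeriv q (q * x) * (q * x) =
      -ellThetaDeriv q x + ellTheta q x / x := by
  have h1 : HasDerivAt (fun y => ellTheta q (q * y)) (ellThetaDeriv q (q * x) * q) x := by
    have h := (differentiableAt_ellTheta hq (mul_ne_zero hq0 hx)).hasDerivAt
    have h' : HasDerivAt (fun y : ℂ => q * y) q x := by
      simpa using (hasDerivAt_id x).const_mul q
    exact h.comp x h'
  have h2 : HasDerivAt (fun y => -ellTheta q y / y)
      ((-ellThetaDeriv q x * x - -ellTheta q x * 1) / x ^ 2) x :=
    (differentiableAt_ellTheta hq hx).hasDerivAt.neg.div (hasDerivAt_id x) hx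
  have h3 : (fun y => ellTheta q (q * y)) =ᶠ[nhds x] fun y => -ellTheta q y / y := by
    filter_upwards [isOpen_ne.mem_nhds hx] with y hy using ellTheta_q_mul hq0 hq hy
  have h4 := h1.unique (h2.congr_of_eventuallyEq h3)
  rw [← mul_assoc, h4]
  field_simp
  ring

theorem ellThetaDeriv_inv (hq : ‖q‖ < 1) {x : ℂ} (hx : x ≠ 0) :
    ellThetaDeriv q x⁻¹ = x * ellThetaDeriv q x - ellTheta q x := by
  have h1 : HasDerivAt (fun y => ellTheta q y⁻¹) (ellThetaDeriv q x⁻¹ * (-(x ^ 2)⁻¹)) x :=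
    (differentiableAt_ellTheta hq (inv_ne_zero hx)).hasDerivAt.comp x (hasDerivAt_inv hx)
  have h2 : HasDerivAt (fun y => -ellTheta q y / y)
      ((-ellThetaDeriv q x * x - -ellTheta q x * 1) / x ^ 2) x :=
    (differentiableAt_ellTheta hq hx).hasDerivAt.neg.div (hasDerivAt_id x) hx
  have h3 : (fun y => ellTheta q y⁻¹) =ᶠ[nhds x] fun y => -ellTheta q y / y := by
    filter_upwards [isOpen_ne.mem_nhds hx] with y hy using ellTheta_inv hq hy
  have h4 := h1.unique (h2.congr_of_eventuallyEq h3)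
  have h5 : (x ^ 2)⁻¹ * x ^ 2 = 1 := inv_mul_cancel₀ (pow_ne_zero 2 hx)
  rw [eq_div_iff (pow_ne_zero 2 hx)] at h4
  linear_combination -h4 - ellThetaDeriv q x⁻¹ * h5

theorem exists_zpow_of_ellTheta_eq_zero (hq0 : q ≠ 0) (hq : ‖q‖ < 1) {x : ℂ} (hx : x ≠ 0)
    (h : ellTheta q x = 0) : ∃ k : ℤ, x = q ^ k := by
  rcases mul_eq_zero.1 h with h | h
  · by_contra! hne
    refine qPochInf_ne_zero hq (fun k hk => ?_) h
    exact hne (-k) (by rw [zpow_neg, zpow_natCast]; exact eq_inv_of_mul_eq_one_left hk)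
  · by_contra! hne
    refine qPochInf_ne_zero hq (fun k hk => ?_) h
    refine hne (k + 1) ?_
    rw [zpow_add₀ hq0, zpow_natCast, zpow_one]
    field_simp at hk
    rw [← hk]
    ring

/-- A property that is invariant under multiplication by `q` holds along `q ^ ℤ`. -/
theorem zpow_mul_induction (hq0 : q ≠ 0) {P : ℂ → Prop}
    (hP : ∀ y, y ≠ 0 → (P (q * y) ↔ P y)) {y : ℂ} (hy : y ≠ 0) (k : ℤ) :
    P (q ^ k * y) ↔ P y := by
  induction k with
  | zero => simp
  | succ k ih =>
    rw [← ih, ← hP _ (mul_ne_zero (zpow_ne_zero k hq0) hy), zpow_add_one₀ hq0]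
    ring_nf
  | pred k ih =>
    rw [← ih, ← hP (q ^ (-(k : ℤ) - 1) * y) (mul_ne_zero (zpow_ne_zero _ hq0) hy),
      zpow_sub_one₀ hq0]
    rw [show q * (q ^ (-(k : ℤ)) * q⁻¹ * y) = q ^ (-(k : ℤ)) * y by field_simp]

/-- The zeros are powers of `q`, and the functional equation carries simplicity from the zero 1,
where the derivative is `-(q)_∞²`, to all the others. -/
theorem ellThetaDeriv_ne_zero (hq0 : q ≠ 0) (hq : ‖q‖ < 1) {x : ℂ} (hx : x ≠ 0)
    (h : ellTheta q x = 0) : ellThetaDeriv q x ≠ 0 := by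
  obtain ⟨k, rfl⟩ := exists_zpow_of_ellTheta_eq_zero hq0 hq hx h
  have key := zpow_mul_induction hq0
    (P := fun y => ellTheta q y = 0 ∧ ellThetaDeriv q y ≠ 0) (fun y hy => by
      have h1 : ellTheta q (q * y) = 0 ↔ ellTheta q y = 0 := by
        rw [ellTheta_q_mul hq0 hq hy]
        simp [hy]
      rw [h1]
      refine and_congr_right fun h0 => not_congr ?_
      have h2 := ellThetaDeriv_q_mul hq0 hq hy
      rw [h0, zero_div, add_zero] at h2
      rw [← mul_eq_zero_iff_right (mul_ne_zero hq0 hy), h2, neg_eq_zero]) one_ne_zero k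
  rw [mul_one] at key
  refine (key.2 ⟨ellTheta_one hq, ?_⟩).2
  rw [ellThetaDeriv_one hq, neg_ne_zero]
  exact pow_ne_zero _ (qPochInf_self_ne_zero hq)

/-- A holomorphic function on `ℂ \ {0}` that is invariant under multiplication by `q` is
constant. -/
theorem eq_of_q_mul_invariant (hq0 : q ≠ 0) (hq : ‖q‖ < 1) {F : ℂ → ℂ}
    (hF : ∀ y, y ≠ 0 → DifferentiableAt ℂ F y) (hinv : ∀ y, y ≠ 0 → F (q * y) = F y)
    {x y : ℂ} (hx : x ≠ 0) (hy : y ≠ 0) : F x = F y := by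
  have hdiff : Differentiable ℂ (F ∘ Complex.exp) := fun u =>
    (hF _ (Complex.exp_ne_zero u)).comp u Complex.differentiable_exp.differentiableAt
  have hK : IsCompact (Metric.closedBall (0 : ℂ) 1 \ Metric.ball 0 ‖q‖) :=
    (isCompact_closedBall _ _).diff Metric.isOpen_ball
  have hcont : ContinuousOn F (Metric.closedBall (0 : ℂ) 1 \ Metric.ball 0 ‖q‖) := by
    intro z hz
    refine (hF z ?_).continuousAt.continuousWithinAt
    rintro rfl
    exact hz.2 (Metric.mem_ball_self (norm_pos_iff.2 hq0))
  -- Every `q`-orbit meets the compact annulus `‖q‖ ≤ ‖z‖ ≤ 1`, so the entire function `F ∘ exp` is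
  -- bounded.
  have hb : Bornology.IsBounded (Set.range (F ∘ Complex.exp)) := by
    refine ((hK.image_of_continuousOn hcont).isBounded).subset ?_
    rintro _ ⟨u, rfl⟩
    set w := Complex.exp u with hw
    have hw0 : w ≠ 0 := Complex.exp_ne_zero u
    obtain ⟨n, hn1, hn2⟩ := exists_mem_Ioc_zpow (norm_pos_iff.2 hw0)
      (one_lt_inv₀ (norm_pos_iff.2 hq0) |>.2 hq)
    refine ⟨q ^ (n + 1) * w, ⟨?_, ?_⟩, ?_⟩
    · rw [mem_closedBall_zero_iff, norm_mul, norm_zpow]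
      rw [inv_zpow] at hn2
      have : 0 < ‖q‖ ^ (n + 1) := zpow_pos (norm_pos_iff.2 hq0) _
      calc ‖q‖ ^ (n + 1) * ‖w‖ ≤ ‖q‖ ^ (n + 1) * (‖q‖ ^ (n + 1))⁻¹ := by gcongr
        _ = 1 := mul_inv_cancel₀ this.ne'
    · rw [mem_ball_zero_iff, norm_mul, norm_zpow, not_lt, zpow_add_one₀ (norm_ne_zero_iff.2 hq0)]
      rw [inv_zpow] at hn1
      have : 0 < ‖q‖ ^ n := zpow_pos (norm_pos_iff.2 hq0) _
      calc ‖q‖ = ‖q‖ ^ n * ‖q‖ * (‖q‖ ^ n)⁻¹ := by field_simp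
        _ ≤ ‖q‖ ^ n * ‖q‖ * ‖w‖ := by gcongr
    · exact (zpow_mul_induction hq0 (P := fun y => F y = F w)
        (fun y hy => by rw [hinv y hy]) hw0 (n + 1)).2 rfl
  have := hdiff.apply_eq_apply_of_bounded hb (Complex.log x) (Complex.log y)
  simpa [Complex.exp_log hx, Complex.exp_log hy] using this

/-- If `N` and `D` are holomorphic on `ℂ \ {0}` with the same multiplier under `y ↦ q y`, and
`N` vanishes at the zeros of `D`, which are all simple, then `N` is a multiple of `D`. -/
theorem exists_eq_const_mul_of_simple_zeros (hq0 : q ≠ 0) (hq : ‖q‖ < 1) {N D μ : ℂ → ℂ}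
    (hN : ∀ y, y ≠ 0 → DifferentiableAt ℂ N y) (hD : ∀ y, y ≠ 0 → DifferentiableAt ℂ D y)
    (hμ : ∀ y, y ≠ 0 → μ y ≠ 0)
    (hNq : ∀ y, y ≠ 0 → N (q * y) = μ y * N y) (hDq : ∀ y, y ≠ 0 → D (q * y) = μ y * D y)
    (hzero : ∀ y, y ≠ 0 → D y = 0 → N y = 0 ∧ deriv D y ≠ 0) :
    ∃ c : ℂ, ∀ y, y ≠ 0 → N y = c * D y := by
  classical
  -- The quotient `N / D` with its removable singularities filled in; near a zero of `D` it is the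
  -- quotient of the `dslope`s.
  set Q : ℂ → ℂ := fun y => if D y = 0 then deriv N y / deriv D y else N y / D y with hQ
  have hon {G : ℂ → ℂ} (hG : ∀ y, y ≠ 0 → DifferentiableAt ℂ G y) :
      DifferentiableOn ℂ G {0}ᶜ := fun y hy => (hG y hy).differentiableWithinAt
  have hQd (w : ℂ) (hw : w ≠ 0) : DifferentiableAt ℂ Q w := by
    have hU : ({0}ᶜ : Set ℂ) ∈ nhds w := isOpen_compl_singleton.mem_nhds hw
    by_cases h0 : D w = 0
    · obtain ⟨hNw, hDw⟩ := hzero w hw h0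
      have hds : dslope D w w ≠ 0 := by rwa [dslope_same]
      have hdN := ((Complex.differentiableOn_dslope hU).2 (hon hN)).differentiableAt hU
      have hdD := ((Complex.differentiableOn_dslope hU).2 (hon hD)).differentiableAt hU
      refine (hdN.div hdD hds).congr_of_eventuallyEq ?_
      filter_upwards [hdD.continuousAt.eventually_ne hds] with y hy
      rcases eq_or_ne y w with rfl | hyw
      · simp [hQ, h0]
      · have h1 := sub_smul_dslope N w y
        have h2 := sub_smul_dslope D w y
        rw [hNw, sub_zero, smul_eq_mul] at h1
        rw [h0, sub_zero, smul_eq_mul] at h2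
        have hyw' := sub_ne_zero.2 hyw
        have hDy : D y ≠ 0 := by rw [← h2]; exact mul_ne_zero hyw' hy
        simp only [hQ, hDy, if_false, Pi.div_apply]
        rw [← h1, ← h2, mul_div_mul_left _ _ hyw']
    · refine ((hN w hw).div (hD w hw) h0).congr_of_eventuallyEq ?_
      filter_upwards [(hD w hw).continuousAt.eventually_ne h0] with y hy
      simp [hQ, hy]
  have hqQ {y : ℂ} (hy : y ≠ 0) (h : D y ≠ 0) : Q (q * y) = Q y := by
    have h1 : D (q * y) ≠ 0 := by rw [hDq y hy]; exact mul_ne_zero (hμ y hy) h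
    simp only [hQ, h, h1, if_false]
    rw [hNq y hy, hDq y hy, mul_div_mul_left _ _ (hμ y hy)]
  have hQinv (w : ℂ) (hw : w ≠ 0) : Q (q * w) = Q w := by
    by_cases h0 : D w = 0
    · have hc1 : ContinuousAt (fun y => Q (q * y)) w :=
        ContinuousAt.comp (hQd _ (mul_ne_zero hq0 hw)).continuousAt (by fun_prop)
      have hc2 : ContinuousAt Q w := (hQd w hw).continuousAt
      have hev : ∀ᶠ y in nhdsWithin w {w}ᶜ, D y ≠ 0 :=
        (hD w hw).hasDerivAt.eventually_ne (hzero w hw h0).2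
      have heq : (fun y => Q (q * y)) =ᶠ[nhdsWithin w {w}ᶜ] Q := by
        filter_upwards [hev, mem_nhdsWithin_of_mem_nhds (isOpen_ne.mem_nhds hw)] with y h1 h2
        exact hqQ h2 h1
      exact tendsto_nhds_unique
        ((hc1.tendsto.mono_left nhdsWithin_le_nhds).congr' heq)
        (hc2.tendsto.mono_left nhdsWithin_le_nhds)
    · exact hqQ hw h0
  refine ⟨Q 1, fun y hy => ?_⟩
  rw [eq_of_q_mul_invariant hq0 hq hQd hQinv one_ne_zero hy]
  by_cases h0 : D y = 0
  · rw [h0, (hzero y hy h0).1, mul_zero]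
  · simp only [hQ, h0, if_false]
    field_simp

end theta

/-! ### The three-term and four-term theta relations -/

section identities

variable {q : ℂ}

/-- The function `θ(-y) + 2 y θ'(-y)`, the numerator of `1 + 2 y θ'(-y) / θ(-y)`. -/
noncomputable def thetaLogNum (q y : ℂ) : ℂ :=
  ellTheta q (-y) + 2 * y * ellThetaDeriv q (-y)

theorem ellTheta_neg_q_mul (hq0 : q ≠ 0) (hq : ‖q‖ < 1) {y : ℂ} (hy : y ≠ 0) :
    ellTheta q (-(q * y)) = ellTheta q (-y) / y := by
  rw [← mul_neg, ellTheta_q_mul hq0 hq (neg_ne_zero.2 hy), neg_div_neg_eq]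

theorem thetaLogNum_q_mul (hq0 : q ≠ 0) (hq : ‖q‖ < 1) {y : ℂ} (hy : y ≠ 0) :
    thetaLogNum q (q * y) = (thetaLogNum q y + 2 * ellTheta q (-y)) / y := by
  have h := ellThetaDeriv_q_mul hq0 hq (neg_ne_zero.2 hy)
  rw [mul_neg, div_neg] at h
  rw [thetaLogNum, thetaLogNum, ellTheta_neg_q_mul hq0 hq hy]
  have h2 : 2 * (q * y) * ellThetaDeriv q (-(q * y)) =
      2 * (ellThetaDeriv q (-y) + ellTheta q (-y) / y) := by linear_combination -2 * h
  rw [h2]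
  field_simp
  ring

theorem thetaLogNum_one (hq : ‖q‖ < 1) : thetaLogNum q 1 = 0 := by
  have h := ellThetaDeriv_inv hq (neg_ne_zero.2 one_ne_zero)
  rw [inv_neg_one] at h
  rw [thetaLogNum]
  linear_combination h

theorem thetaLogNum_neg_one (hq : ‖q‖ < 1) : thetaLogNum q (-1) = 2 * qPochInf q q ^ 2 := by
  rw [thetaLogNum, neg_neg, ellTheta_one hq, ellThetaDeriv_one hq]
  ring

/-- The difference of the two sides of the three-term theta relation. -/
noncomputable def threeTermDefect (q z y : ℂ) : ℂ :=
  thetaLogNum q y * ellTheta q (-z) * ellTheta q (-(y * z)) +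
    ellTheta q (-y) * thetaLogNum q z * ellTheta q (-(y * z)) -
    ellTheta q (-y) * ellTheta q (-z) * thetaLogNum q (y * z) -
    qPochInf q q ^ 2 / qPochInf (-q) q ^ 2 *
      (ellTheta q y * ellTheta q z * ellTheta q (y * z))

/-- Under `y ↦ q y` the quotients `thetaLogNum / θ(-·)` at `y` and at `y z` both grow by 2, and
these shifts cancel. -/
theorem threeTermDefect_q_mul (hq0 : q ≠ 0) (hq : ‖q‖ < 1) {y z : ℂ} (hy : y ≠ 0) (hz : z ≠ 0) :
    threeTermDefect q z (q * y) = 1 / (y * (y * z)) * threeTermDefect q z y := by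
  have hyz := mul_ne_zero hy hz
  unfold threeTermDefect
  rw [mul_assoc q y z, ellTheta_neg_q_mul hq0 hq hy, ellTheta_neg_q_mul hq0 hq hyz,
    thetaLogNum_q_mul hq0 hq hy, thetaLogNum_q_mul hq0 hq hyz, ellTheta_q_mul hq0 hq hy,
    ellTheta_q_mul hq0 hq hyz]
  generalize qPochInf q q ^ 2 / qPochInf (-q) q ^ 2 = c
  field_simp
  ring

theorem threeTermDefect_comm (q y z : ℂ) : threeTermDefect q z y = threeTermDefect q y z := by
  unfold threeTermDefect
  rw [mul_comm y z]
  ring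

/-- This point fixes the constant `(q)_∞² / (-q)_∞²`, as the ratio of `thetaLogNum q (-1)` to
`θ(-1)`. -/
theorem threeTermDefect_neg_one (hq : ‖q‖ < 1) (z : ℂ) : threeTermDefect q z (-1) = 0 := by
  unfold threeTermDefect
  have hb := qPochInf_neg_self_ne_zero hq
  rw [thetaLogNum_neg_one hq, ellTheta_neg_one hq, neg_neg, ellTheta_one hq, neg_one_mul, neg_neg]
  field_simp
  ring

theorem threeTermDefect_neg_inv (hq : ‖q‖ < 1) {z : ℂ} (hz : z ≠ 0) :
    threeTermDefect q z (-z⁻¹) = 0 := by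
  unfold threeTermDefect
  have hb := qPochInf_neg_self_ne_zero hq
  have h1 : -z⁻¹ * z = -1 := by field_simp
  have h2 : ellTheta q (-z⁻¹) = ellTheta q (-z) / z := by
    rw [← inv_neg, ellTheta_inv hq (neg_ne_zero.2 hz), neg_div_neg_eq]
  rw [h1, thetaLogNum_neg_one hq, ellTheta_neg_one hq, neg_neg, neg_neg, ellTheta_one hq, h2,
    ellTheta_inv hq hz]
  field_simp
  ring

theorem threeTermDefect_one (hq : ‖q‖ < 1) (z : ℂ) : threeTermDefect q z 1 = 0 := by
  unfold threeTermDefect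
  rw [thetaLogNum_one hq, ellTheta_one hq, one_mul]
  ring

theorem ellTheta_q_mul_eq_zero_iff (hq0 : q ≠ 0) (hq : ‖q‖ < 1) {y : ℂ} (hy : y ≠ 0) :
    ellTheta q (q * y) = 0 ↔ ellTheta q y = 0 := by
  rw [ellTheta_q_mul hq0 hq hy]
  simp [hy]

theorem threeTermDefect_eq_zero (hq0 : q ≠ 0) (hq : ‖q‖ < 1) {y z : ℂ} (hy : y ≠ 0) (hz : z ≠ 0)
    (hψ : ellTheta q (-z) ≠ 0) : threeTermDefect q z y = 0 := by
  have hiter (z : ℂ) (hz : z ≠ 0) (w : ℂ) (hw : w ≠ 0) (k : ℤ) :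
      threeTermDefect q z (q ^ k * w) = 0 ↔ threeTermDefect q z w = 0 :=
    zpow_mul_induction hq0 (P := fun w => threeTermDefect q z w = 0) (fun w hw => by
      rw [threeTermDefect_q_mul hq0 hq hw hz]
      simp [hw, hz]) hw k
  -- If `z` is a power of `q`, the two families of zeros of `θ(-y) θ(-y z)` coincide and are not
  -- simple. Then the symmetry in `y` and `z` reduces the claim to the value at 1.
  by_cases hθ : ellTheta q z = 0
  · obtain ⟨k, rfl⟩ := exists_zpow_of_ellTheta_eq_zero hq0 hq hz hθ
    have := (hiter y hy 1 one_ne_zero k).2 (threeTermDefect_one hq y)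
    rwa [mul_one, threeTermDefect_comm] at this
  have hθiter (w : ℂ) (hw : w ≠ 0) (k : ℤ) : ellTheta q (q ^ k * w) = 0 ↔ ellTheta q w = 0 :=
    zpow_mul_induction hq0 (P := fun w => ellTheta q w = 0)
      (fun w hw => ellTheta_q_mul_eq_zero_iff hq0 hq hw) hw k
  have hψd (c w : ℂ) (h : c * w ≠ 0) : HasDerivAt (fun w => ellTheta q (-(w * c)))
      (-(ellThetaDeriv q (-(w * c)) * c)) w := by
    have h1 : HasDerivAt (fun w : ℂ => -(w * c)) (-c) w := by
      simpa using ((hasDerivAt_id w).mul_const c).fun_neg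
    have h2 : -(w * c) ≠ 0 := neg_ne_zero.2 (by rwa [mul_comm])
    have h3 := HasDerivAt.comp w (differentiableAt_ellTheta hq h2).hasDerivAt h1
    rwa [mul_neg] at h3
  have hψ1 (w : ℂ) (h : w ≠ 0) : HasDerivAt (fun w => ellTheta q (-w))
      (-ellThetaDeriv q (-w)) w := by
    simpa using hψd 1 w (by simpa using h)
  have hDd (w : ℂ) (hw : w ≠ 0) :
      HasDerivAt (fun w => ellTheta q (-w) * ellTheta q (-(w * z)))
        (-ellThetaDeriv q (-w) * ellTheta q (-(w * z)) +
          ellTheta q (-w) * (-(ellThetaDeriv q (-(w * z)) * z))) w :=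
    (hψ1 w hw).mul (hψd z w (mul_ne_zero hz hw))
  have hφd (w : ℂ) (hw : w ≠ 0) : DifferentiableAt ℂ (thetaLogNum q) w := by
    have h1 := (hψ1 w hw).differentiableAt
    have h2 : DifferentiableAt ℂ (fun w => ellThetaDeriv q (-w)) w :=
      DifferentiableAt.comp w (differentiableAt_ellThetaDeriv hq (neg_ne_zero.2 hw))
        differentiableAt_id.neg
    exact h1.add ((differentiableAt_id.const_mul 2).mul h2)
  have hNd (w : ℂ) (hw : w ≠ 0) : DifferentiableAt ℂ (threeTermDefect q z) w := by
    have h1 := (hψ1 w hw).differentiableAt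
    have h2 := (hψd z w (mul_ne_zero hz hw)).differentiableAt
    have h3 := hφd w hw
    have hlin : DifferentiableAt ℂ (fun w => w * z) w := differentiableAt_id.mul_const z
    have h4 : DifferentiableAt ℂ (fun w => thetaLogNum q (w * z)) w :=
      DifferentiableAt.comp (g := thetaLogNum q) w (hφd _ (mul_ne_zero hw hz)) hlin
    have h5 := differentiableAt_ellTheta hq hw
    have h6 : DifferentiableAt ℂ (fun w => ellTheta q (w * z)) w :=
      DifferentiableAt.comp (g := ellTheta q) w
        (differentiableAt_ellTheta hq (mul_ne_zero hw hz)) hlin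
    unfold threeTermDefect
    fun_prop
  obtain ⟨c, hc⟩ := exists_eq_const_mul_of_simple_zeros hq0 hq
    (N := threeTermDefect q z) (D := fun w => ellTheta q (-w) * ellTheta q (-(w * z)))
    (μ := fun w => 1 / (w * (w * z))) hNd (fun w hw => (hDd w hw).differentiableAt)
    (fun w hw => one_div_ne_zero (mul_ne_zero hw (mul_ne_zero hw hz)))
    (fun w hw => threeTermDefect_q_mul hq0 hq hw hz)
    (fun w hw => by
      rw [mul_assoc q w z, ellTheta_neg_q_mul hq0 hq hw,
        ellTheta_neg_q_mul hq0 hq (mul_ne_zero hw hz)]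
      field_simp)
    (fun w hw h0 => by
      rw [(hDd w hw).deriv]
      rcases mul_eq_zero.1 h0 with h | h
      · obtain ⟨k, hk⟩ := exists_zpow_of_ellTheta_eq_zero hq0 hq (neg_ne_zero.2 hw) h
        have hd := ellThetaDeriv_ne_zero hq0 hq (neg_ne_zero.2 hw) h
        have hwk : w = q ^ k * (-1) := by rw [← hk]; ring
        refine ⟨?_, ?_⟩
        · rw [hwk]
          exact (hiter z hz _ (by norm_num) k).2 (threeTermDefect_neg_one hq z)
        -- Only one summand of the derivative survives; its other factor is nonzero because `z` is
        -- not a power of `q`.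
        · rw [h, zero_mul, add_zero]
          refine mul_ne_zero (neg_ne_zero.2 hd) ?_
          rw [← neg_mul, hk, ne_eq, hθiter z hz]
          exact hθ
      · have hwz : -(w * z) ≠ 0 := neg_ne_zero.2 (mul_ne_zero hw hz)
        obtain ⟨k, hk⟩ := exists_zpow_of_ellTheta_eq_zero hq0 hq hwz h
        have hd := ellThetaDeriv_ne_zero hq0 hq hwz h
        have hwk : w = q ^ k * (-z⁻¹) := by rw [← hk]; field_simp
        refine ⟨?_, ?_⟩
        · rw [hwk]
          exact (hiter z hz _ (neg_ne_zero.2 (inv_ne_zero hz)) k).2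
            (threeTermDefect_neg_inv hq hz)
        · rw [h, mul_zero, zero_add]
          refine mul_ne_zero ?_ (neg_ne_zero.2 (mul_ne_zero hd hz))
          rw [hwk, ← mul_neg, neg_neg, ne_eq, hθiter _ (inv_ne_zero hz), ellTheta_inv hq hz]
          simp [hθ, hz])
  have h1 := hc 1 one_ne_zero
  rw [threeTermDefect_one hq, one_mul] at h1
  have hc0 : c = 0 := (mul_eq_zero.1 h1.symm).resolve_right
    (mul_ne_zero (ellTheta_neg_one_ne_zero hq) hψ)
  rw [hc y hy, hc0, zero_mul]

/-- The quotient `θ(v / u) / θ(-v / u)`. -/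
noncomputable def thetaQuot (q u v : ℂ) : ℂ := ellTheta q (v / u) / ellTheta q (-(v / u))

/-- The logarithmic derivative `1 + 2 v θ'(-v / u) / (u θ(-v / u))`. -/
noncomputable def thetaLog (q u v : ℂ) : ℂ :=
  1 + 2 * (v * ellThetaDeriv q (-(v / u)) / (u * ellTheta q (-(v / u))))

theorem thetaLog_eq_div {u v : ℂ} (hu : u ≠ 0) (h : ellTheta q (-(v / u)) ≠ 0) :
    thetaLog q u v = thetaLogNum q (v / u) / ellTheta q (-(v / u)) := by
  rw [thetaLog, thetaLogNum]
  field_simp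

theorem thetaLog_add_sub (hq0 : q ≠ 0) (hq : ‖q‖ < 1) {u v w : ℂ} (hu : u ≠ 0) (hv : v ≠ 0)
    (hw : w ≠ 0) (huv : ellTheta q (-(v / u)) ≠ 0) (huw : ellTheta q (-(w / u)) ≠ 0)
    (hvw : ellTheta q (-(w / v)) ≠ 0) :
    thetaLog q u v + thetaLog q v w - thetaLog q u w =
      qPochInf q q ^ 2 / qPochInf (-q) q ^ 2 *
        (thetaQuot q u v * thetaQuot q v w * thetaQuot q u w) := by
  have h := threeTermDefect_eq_zero hq0 hq (div_ne_zero hv hu) (div_ne_zero hw hv) hvw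
  have e : v / u * (w / v) = w / u := by field_simp
  rw [threeTermDefect, e] at h
  rw [thetaLog_eq_div hu huv, thetaLog_eq_div hv hvw, thetaLog_eq_div hu huw]
  unfold thetaQuot
  generalize qPochInf q q ^ 2 / qPochInf (-q) q ^ 2 = c at *
  field_simp
  linear_combination h

theorem ellTheta_neg_div_symm (hq : ‖q‖ < 1) {u v : ℂ} (hu : u ≠ 0) (hv : v ≠ 0) :
    ellTheta q (-(u / v)) = ellTheta q (-(v / u)) / (v / u) := by
  rw [← inv_div v u, ← inv_neg, ellTheta_inv hq (neg_ne_zero.2 (div_ne_zero hv hu)),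
    neg_div_neg_eq]

theorem thetaQuot_symm (hq : ‖q‖ < 1) {u v : ℂ} (hu : u ≠ 0) (hv : v ≠ 0) :
    thetaQuot q v u = -thetaQuot q u v := by
  have hvu := div_ne_zero hv hu
  rw [thetaQuot, thetaQuot, ellTheta_neg_div_symm hq hu hv, ← inv_div v u, ellTheta_inv hq hvu,
    div_div_div_cancel_right₀ hvu, neg_div]

theorem thetaQuot_self (hq : ‖q‖ < 1) {u : ℂ} (hu : u ≠ 0) : thetaQuot q u u = 0 := by
  rw [thetaQuot, div_self hu, ellTheta_one hq, zero_div]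

theorem thetaLog_symm (hq : ‖q‖ < 1) {u v : ℂ} (hu : u ≠ 0) (hv : v ≠ 0)
    (h : ellTheta q (-(v / u)) ≠ 0) : thetaLog q v u = -thetaLog q u v := by
  have h1 := ellTheta_neg_div_symm hq hu hv
  have h' : ellTheta q (-(u / v)) ≠ 0 := by
    rw [h1]; exact div_ne_zero h (div_ne_zero hv hu)
  have h2 : ellThetaDeriv q (-(u / v)) =
      -(v / u) * ellThetaDeriv q (-(v / u)) - ellTheta q (-(v / u)) := by
    rw [← inv_div v u, ← inv_neg, ellThetaDeriv_inv hq (neg_ne_zero.2 (div_ne_zero hv hu))]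
  rw [thetaLog_eq_div hv h', thetaLog_eq_div hu h, thetaLogNum, thetaLogNum, h2, h1]
  generalize ellTheta q (-(v / u)) = t at *
  generalize ellThetaDeriv q (-(v / u)) = t' at *
  field_simp
  ring

theorem thetaQuot_neg (q u v : ℂ) : thetaQuot q u (-v) = (thetaQuot q u v)⁻¹ := by
  rw [thetaQuot, thetaQuot, neg_div, neg_neg, inv_div]

/-- Here `v = q ^ k * u`, and each factor `q` only changes the sign of the quotient, so `ε` comes
out as `(-1) ^ k`. -/
theorem thetaQuot_proportional (hq0 : q ≠ 0) (hq : ‖q‖ < 1) {u v : ℂ} (hu : u ≠ 0) (hv : v ≠ 0)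
    (h : ellTheta q (v / u) = 0) :
    ∃ ε : ℂ, ∀ w, w ≠ 0 → thetaQuot q w v = ε * thetaQuot q w u := by
  obtain ⟨k, hk⟩ := exists_zpow_of_ellTheta_eq_zero hq0 hq (div_ne_zero hv hu) h
  have hvk : v = q ^ k * u := by rw [← hk]; field_simp
  have hstep (w y : ℂ) (hw : w ≠ 0) (hy : y ≠ 0) : thetaQuot q w (q * y) = -thetaQuot q w y := by
    have hyw := div_ne_zero hy hw
    rw [thetaQuot, thetaQuot, mul_div_assoc, ellTheta_q_mul hq0 hq hyw,
      ellTheta_neg_q_mul hq0 hq hyw, div_div_div_cancel_right₀ hyw, neg_div]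
  rw [hvk]
  refine (zpow_mul_induction hq0
    (P := fun v => ∃ ε : ℂ, ∀ w, w ≠ 0 → thetaQuot q w v = ε * thetaQuot q w u)
    (fun y hy => ⟨?_, ?_⟩) hu k).2 ⟨1, fun w _ => (one_mul _).symm⟩ <;>
  · rintro ⟨ε, hε⟩
    refine ⟨-ε, fun w hw => ?_⟩
    have h1 := hstep w y hw hy
    have h2 := hε w hw
    linear_combination h1 - h2

theorem thetaQuot_four_term (hq0 : q ≠ 0) (hq : ‖q‖ < 1) {a b c d : ℂ} (ha : a ≠ 0) (hb : b ≠ 0)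
    (hc : c ≠ 0) (hd : d ≠ 0) (hab : ellTheta q (-(b / a)) ≠ 0)
    (hac : ellTheta q (-(c / a)) ≠ 0) (had : ellTheta q (-(d / a)) ≠ 0)
    (hbc : ellTheta q (-(c / b)) ≠ 0) (hbd : ellTheta q (-(d / b)) ≠ 0)
    (hcd : ellTheta q (-(d / c)) ≠ 0) :
    thetaQuot q a b * thetaQuot q c d - thetaQuot q a c * thetaQuot q b d +
        thetaQuot q a d * thetaQuot q b c =
      thetaQuot q a b * thetaQuot q a c * thetaQuot q a d * thetaQuot q b c *
        thetaQuot q b d * thetaQuot q c d := by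
  -- The substitution `d ↦ -d` needs `θ(d/a)`, `θ(d/b)` and `θ(d/c)` nonzero. If one of them
  -- vanishes, `d` may be replaced by that variable up to a scalar, and both sides agree by
  -- antisymmetry.
  by_cases h1 : ellTheta q (d / a) = 0
  · obtain ⟨ε, hε⟩ := thetaQuot_proportional hq0 hq ha hd h1
    rw [hε a ha, hε b hb, hε c hc, thetaQuot_self hq ha, thetaQuot_symm hq ha hb,
      thetaQuot_symm hq ha hc]
    ring
  by_cases h2 : ellTheta q (d / b) = 0
  · obtain ⟨ε, hε⟩ := thetaQuot_proportional hq0 hq hb hd h2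
    rw [hε a ha, hε b hb, hε c hc, thetaQuot_self hq hb, thetaQuot_symm hq hb hc]
    ring
  by_cases h3 : ellTheta q (d / c) = 0
  · obtain ⟨ε, hε⟩ := thetaQuot_proportional hq0 hq hc hd h3
    rw [hε a ha, hε b hb, hε c hc, thetaQuot_self hq hc]
    ring
  have hneg {u : ℂ} (h : ellTheta q (d / u) ≠ 0) : ellTheta q (-(-d / u)) ≠ 0 := by
    rwa [neg_div, neg_neg]
  have hd' := neg_ne_zero.2 hd
  have t1 := thetaLog_add_sub hq0 hq ha hb hc hab hac hbc
  have t2 := thetaLog_add_sub hq0 hq ha hc hd' hac (hneg h1) (hneg h3)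
  have t3 := thetaLog_add_sub hq0 hq ha hb hd' hab (hneg h1) (hneg h2)
  have t4 := thetaLog_add_sub hq0 hq hb hc hd' hbc (hneg h2) (hneg h3)
  rw [thetaQuot_neg, thetaQuot_neg] at t2 t3 t4
  have hK : qPochInf q q ^ 2 / qPochInf (-q) q ^ 2 ≠ 0 :=
    div_ne_zero (pow_ne_zero _ (qPochInf_self_ne_zero hq))
      (pow_ne_zero _ (qPochInf_neg_self_ne_zero hq))
  have n1 : thetaQuot q a d ≠ 0 := div_ne_zero h1 had
  have n2 : thetaQuot q b d ≠ 0 := div_ne_zero h2 hbd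
  have n3 : thetaQuot q c d ≠ 0 := div_ne_zero h3 hcd
  generalize qPochInf q q ^ 2 / qPochInf (-q) q ^ 2 = K at *
  -- The alternating sum of the four coboundary relations: every `thetaLog` cancels. Multiplying by
  -- the three quotients that contain `d` gives the claim.
  have t5 : K * (thetaQuot q a b * thetaQuot q b c * thetaQuot q a c +
      thetaQuot q a c * (thetaQuot q c d)⁻¹ * (thetaQuot q a d)⁻¹ -
      thetaQuot q a b * (thetaQuot q b d)⁻¹ * (thetaQuot q a d)⁻¹ -
      thetaQuot q b c * (thetaQuot q c d)⁻¹ * (thetaQuot q b d)⁻¹) = 0 := by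
    linear_combination t3 + t4 - t1 - t2
  have t6 := (mul_eq_zero.1 t5).resolve_left hK
  field_simp at t6
  linear_combination -t6

end identities

/-! ### Splitting off the last index of a product over pairs -/

section product

variable {α : Type*} [CommMonoid α]

theorem prod_prod_Ioi_castSucc {n : ℕ} (F : Fin (n + 1) → Fin (n + 1) → α) :
    ∏ i, ∏ j ∈ Finset.Ioi i, F i j =
      (∏ i : Fin n, ∏ j ∈ Finset.Ioi i, F i.castSucc j.castSucc) *
        ∏ i : Fin n, F i.castSucc (Fin.last n) := by
  have h (k : ℕ) (G : Fin k → Fin k → α) (i : Fin k) :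
      ∏ j ∈ Finset.Ioi i, G i j = ∏ j, if i < j then G i j else 1 := by
    rw [← Finset.prod_filter]
    congr 1
    ext j
    simp
  simp_rw [h (n + 1), h n fun i j => F i.castSucc j.castSucc]
  rw [Fin.prod_univ_castSucc]
  simp_rw [Fin.prod_univ_castSucc (n := n)]
  simp [Finset.prod_mul_distrib, Fin.castSucc_lt_last, (Fin.castSucc_lt_last _).not_gt]

end product

/-! ### Evaluation of the two pfaffians -/

section pfaffians

variable {q : ℂ}

theorem pfaff_thetaQuot (hq0 : q ≠ 0) (hq : ‖q‖ < 1) (m : ℕ) (x : Fin (2 * m) → ℂ)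
    (hx : ∀ i, x i ≠ 0) (hθ : ∀ i j, i ≠ j → ellTheta q (-(x j / x i)) ≠ 0) :
    pfaff (Matrix.of fun i j => thetaQuot q (x i) (x j)) =
      ∏ i, ∏ j ∈ Finset.Ioi i, thetaQuot q (x i) (x j) := by
  induction m with
  | zero =>
    rw [pfaff_eq (M := 0) rfl le_rfl]
    simp [pairProd]
  | succ m ih =>
    change Fin (2 * m + 2) → ℂ at x
    have hθ' (i j) : ellTheta q (-(x j / x i)) ≠ 0 := by
      rcases eq_or_ne i j with rfl | h
      · rw [div_self (hx i)]
        exact ellTheta_neg_one_ne_zero hq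
      · exact hθ i j h
    set e : Fin (2 * m + 2) := (Fin.last (2 * m)).castSucc with he
    set l : Fin (2 * m + 2) := Fin.last (2 * m + 1) with hl
    have hel : e ≠ l := (Fin.castSucc_lt_last _).ne
    have hA (i j) : (Matrix.of fun i j => thetaQuot q (x i) (x j)) j i =
        -(Matrix.of fun i j => thetaQuot q (x i) (x j)) i j :=
      thetaQuot_symm hq (hx i) (hx j)
    -- With a vanishing pivot no elimination is possible, but then rows `e` and `l` are proportional
    -- and both sides are zero.
    by_cases hp : thetaQuot q (x e) (x l) = 0
    · have h0 : ellTheta q (x l / x e) = 0 := (div_eq_zero_iff.1 hp).resolve_right (hθ' e l)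
      obtain ⟨ε, hε⟩ := thetaQuot_proportional hq0 hq (hx e) (hx l) h0
      have hz := pfaff_eq_zero_of_proportional (M := m + 1) hA hel ε fun j => by
        change thetaQuot q (x l) (x j) = ε * thetaQuot q (x e) (x j)
        rw [thetaQuot_symm hq (hx j) (hx l), thetaQuot_symm hq (hx j) (hx e), hε _ (hx j)]
        ring
      refine hz.trans (Eq.symm ?_)
      exact Finset.prod_eq_zero (Finset.mem_univ e) (Finset.prod_eq_zero (i := l)
        (Finset.mem_Ioi.2 (Fin.castSucc_lt_last _)) hp)
    · have hs := pfaff_schur hA he hl hp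
      have hih := ih (fun i => x i.castSucc.castSucc) (fun i => hx _) fun i j _ => hθ' _ _
      have hD : (Matrix.of fun i j : Fin (2 * m) =>
          thetaQuot q (x i.castSucc.castSucc) (x j.castSucc.castSucc) -
          (thetaQuot q (x i.castSucc.castSucc) (x e) * thetaQuot q (x j.castSucc.castSucc) (x l) -
          thetaQuot q (x i.castSucc.castSucc) (x l) * thetaQuot q (x j.castSucc.castSucc) (x e)) /
            thetaQuot q (x e) (x l)) =
          Matrix.of fun i j =>
            (thetaQuot q (x i.castSucc.castSucc) (x e) *
              thetaQuot q (x i.castSucc.castSucc) (x l)) *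
            (thetaQuot q (x j.castSucc.castSucc) (x e) *
              thetaQuot q (x j.castSucc.castSucc) (x l)) *
            (Matrix.of fun i j : Fin (2 * m) =>
              thetaQuot q (x i.castSucc.castSucc) (x j.castSucc.castSucc)) i j := by
        ext i j
        have h4 := thetaQuot_four_term hq0 hq (hx i.castSucc.castSucc) (hx j.castSucc.castSucc)
          (hx e) (hx l) (hθ' _ _) (hθ' _ _) (hθ' _ _) (hθ' _ _) (hθ' _ _) (hθ' _ _)
        simp only [Matrix.of_apply]
        field_simp
        linear_combination h4
      refine hs.trans ?_
      simp only [Matrix.of_apply]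
      rw [hD, pfaff_scale, hih]
      refine Eq.trans ?_ (prod_prod_Ioi_castSucc (n := 2 * m + 1) _).symm
      rw [prod_prod_Ioi_castSucc, Fin.prod_univ_castSucc (n := 2 * m), Finset.prod_mul_distrib]
      simp only [← he, ← hl]
      ring

theorem pfaff_thetaLog (hq0 : q ≠ 0) (hq : ‖q‖ < 1) (m : ℕ) (x : Fin (2 * m + 1) → ℂ)
    (hx : ∀ i, x i ≠ 0) (hθ : ∀ i j, i ≠ j → ellTheta q (-(x j / x i)) ≠ 0) :
    pfaff (Matrix.of fun i j => thetaLog q (x i) (x j)) =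
      qPochInf q q ^ (2 * m) / qPochInf (-q) q ^ (2 * m) *
        ∏ i, ∏ j ∈ Finset.Ioi i, thetaQuot q (x i) (x j) := by
  have hθ' (i j) : ellTheta q (-(x j / x i)) ≠ 0 := by
    rcases eq_or_ne i j with rfl | h
    · rw [div_self (hx i)]
      exact ellTheta_neg_one_ne_zero hq
    · exact hθ i j h
  -- The antisymmetric bordering by ones. Its pivot, the last variable against the border, is 1, so
  -- the elimination never degenerates.
  let A : Matrix (Fin (2 * m + 2)) (Fin (2 * m + 2)) ℂ := Matrix.of fun i j =>
    Fin.lastCases (motive := fun _ => ℂ)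
      (Fin.lastCases (motive := fun _ => ℂ) 0 (fun _ => -1) j)
      (fun i' => Fin.lastCases (motive := fun _ => ℂ) 1
        (fun j' => thetaLog q (x i') (x j')) j) i
  have hA1 (i) : A (Fin.castSucc i) (Fin.last _) = 1 := by simp [A]
  have hA2 (i j) : A (Fin.castSucc i) (Fin.castSucc j) = thetaLog q (x i) (x j) := by simp [A]
  have hA (i j) : A j i = -A i j := by
    induction i using Fin.lastCases <;> induction j using Fin.lastCases
    · simp [A]
    · simp [A]
    · simp [A]
    · rw [hA2, hA2, thetaLog_symm hq (hx _) (hx _) (hθ' _ _)]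
  have hsub : A.submatrix Fin.castSucc Fin.castSucc =
      Matrix.of fun i j => thetaLog q (x i) (x j) := by
    ext i j
    exact hA2 i j
  rw [← hsub, ← pfaff_border hA hA1, pfaff_schur hA rfl rfl (by rw [hA1]; exact one_ne_zero)]
  simp only [hA1, hA2]
  have hD : (Matrix.of fun i j : Fin (2 * m) =>
      thetaLog q (x i.castSucc) (x j.castSucc) -
        (thetaLog q (x i.castSucc) (x (Fin.last _)) * 1 -
          1 * thetaLog q (x j.castSucc) (x (Fin.last _))) / 1) =
      Matrix.of fun i j => qPochInf q q ^ 2 / qPochInf (-q) q ^ 2 *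
        (Matrix.of fun i j : Fin (2 * m) => thetaQuot q (x i.castSucc) (x (Fin.last _)) *
          thetaQuot q (x j.castSucc) (x (Fin.last _)) *
            (Matrix.of fun i j : Fin (2 * m) =>
              thetaQuot q (x i.castSucc) (x j.castSucc)) i j) i j := by
    ext i j
    have h3 := thetaLog_add_sub hq0 hq (hx i.castSucc) (hx j.castSucc) (hx (Fin.last _))
      (hθ' _ _) (hθ' _ _) (hθ' _ _)
    simp only [Matrix.of_apply]
    linear_combination h3
  rw [hD, pfaff_const_mul, pfaff_scale, pfaff_thetaQuot hq0 hq m (fun i => x i.castSucc)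
    (fun i => hx _) (fun i j _ => hθ' _ _), prod_prod_Ioi_castSucc, div_pow, pow_mul, pow_mul]
  ring

end pfaffians

theorem lemma3p1 (q : ℝ) (hq0 : 0 < q) (hq1 : q < 1) (m : ℕ) :
    (∀ x : Fin (2 * m) → ℂ, (∀ i, x i ≠ 0) →
      (∀ i j, i ≠ j → ellTheta q (-(x j / x i)) ≠ 0) →
      pfaff (Matrix.of fun i j => ellTheta q (x j / x i) / ellTheta q (-(x j / x i))) =
        ∏ i, ∏ j ∈ Finset.Ioi i, ellTheta q (x j / x i) / ellTheta q (-(x j / x i))) ∧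
    (∀ x : Fin (2 * m + 1) → ℂ, (∀ i, x i ≠ 0) →
      (∀ i j, i ≠ j → ellTheta q (-(x j / x i)) ≠ 0) →
      pfaff (Matrix.of fun i j =>
          1 + 2 * (x j * ellThetaDeriv q (-(x j / x i)) / (x i * ellTheta q (-(x j / x i))))) =
        qPochInf q q ^ (2 * m) / qPochInf (-q) q ^ (2 * m) *
          ∏ i, ∏ j ∈ Finset.Ioi i, ellTheta q (x j / x i) / ellTheta q (-(x j / x i))) := by
  have hq0' : (q : ℂ) ≠ 0 := Complex.ofReal_ne_zero.2 hq0.ne'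
  have hq1' : ‖(q : ℂ)‖ < 1 := by
    rwa [Complex.norm_real, Real.norm_of_nonneg hq0.le]
  exact ⟨pfaff_thetaQuot hq0' hq1' m, pfaff_thetaLog hq0' hq1' m⟩
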